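/- For every $N$ let $J(N)$ be a positive integer and let $X_{1,N},\dots,X_{J(N),N}$ be independent random variables. Suppose that for every $N$ the index set $\{1,\dots,J(N)\}$ is the union of two disjoint sets $\mathcal J^1_N$ and $\mathcal J^2_N$ such that - for $j\in\mathcal J^1_N$, $X_{j,N}$ has the truncated geometric distribution with parameters $\rho_{j,N}\ge 0$ and $c_{j,N}\in\mathbb N=\{0,1,2,\dots\}$, that is, $\mathbb P(X_{j,N}=k)=\rho_{j,N}^k\big/\sum_{h=0}^{c_{j,N}}\rho_{j,N}^h$ for $k\in\{0,\dots,c_{j,N}\}$ (with $0^0=1$); - for $j\in\mathcal J^2_N$, $X_{j,N}$ has the Poisson distribution with parameter $\lambda_{j,N}>0$. Let $S_N=\sum_{j=1}^{J(N)}X_{j,N}$, let $a_N=\mathbb E(S_N)$, and let $b_N=\sqrt{\mathbb E\left[(S_N-a_N)^2\right]}$ be the standard deviation of $S_N$. Assume that (i) there exists $C<+\infty$ such that $c_{j,N}\le C$ for all $N$ and all $j\in\mathcal J^1_N$; (ii) $\lim_{N\to\infty}b_N=+\infty$. Then $$\lim_{N\to\infty}\ \sup_{k\in\mathbb Z}\left|\,b_N\sqrt{2\pi}\;\mathbb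 P(S_N=k)-\exp\left(-\frac{(k-a_N)^2}{2b_N^2}\right)\right|=0 .$$ -/

import Mathlib

open MeasureTheory ProbabilityTheory Filter Topology
open scoped NNReal ENNReal

/-- The truncated geometric distribution on `{0, …, c}` with parameters `ρ ≥ 0` and `c`:
the point `k ≤ c` has mass `ρ ^ k / ∑_{h=0}^{c} ρ ^ h` (with `0 ^ 0 = 1`). -/
noncomputable def truncGeometricMeasure (ρ : ℝ≥0) (c : ℕ) : Measure ℕ :=
  ∑ k ∈ Finset.range (c + 1),
    ENNReal.ofReal ((ρ : ℝ) ^ k / ∑ h ∈ Finset.range (c + 1), (ρ : ℝ) ^ h) • Measure.dirac k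

theorem truncGeometricMeasure_singleton (ρ : ℝ≥0) (c k : ℕ) :
    truncGeometricMeasure ρ c {k} =
      if k ≤ c then
        ENNReal.ofReal ((ρ : ℝ) ^ k / ∑ h ∈ Finset.range (c + 1), (ρ : ℝ) ^ h)
      else 0 := by
  simp only [truncGeometricMeasure, Measure.finsetSum_apply, Measure.smul_apply, smul_eq_mul,
    Measure.dirac_apply' _ (measurableSet_singleton k), Set.indicator_apply,
    Set.mem_singleton_iff, Pi.one_apply, mul_ite, mul_one, mul_zero, Finset.sum_ite_eq',
    Finset.mem_range, Nat.lt_succ_iff]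

instance truncGeometricMeasure_isProbabilityMeasure (ρ : ℝ≥0) (c : ℕ) :
    IsProbabilityMeasure (truncGeometricMeasure ρ c) := by
  have hpos : 0 < ∑ h ∈ Finset.range (c + 1), (ρ : ℝ) ^ h := by
    rw [Finset.sum_range_succ']
    have : 0 ≤ ∑ h ∈ Finset.range c, (ρ : ℝ) ^ (h + 1) :=
      Finset.sum_nonneg fun _ _ => by positivity
    simp only [pow_zero]
    linarith
  constructor
  simp only [truncGeometricMeasure, Measure.finsetSum_apply, Measure.smul_apply, smul_eq_mul,
    measure_univ, mul_one]
  rw [← ENNReal.ofReal_sum_of_nonneg fun _ _ => by positivity, ← Finset.sum_div,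
    div_self hpos.ne', ENNReal.ofReal_one]

/-- The expectation `a = E(S)` of an `ℕ`-valued random variable. -/
noncomputable def meanOf {Ω : Type*} [MeasurableSpace Ω] (P : Measure Ω) (S : Ω → ℕ) : ℝ :=
  ∫ ω, (S ω : ℝ) ∂P

/-- The standard deviation `b = E((S - a) ^ 2) ^ (1 / 2)` of an `ℕ`-valued random variable. -/
noncomputable def stdDevOf {Ω : Type*} [MeasurableSpace Ω] (P : Measure Ω) (S : Ω → ℕ) : ℝ :=
  Real.sqrt (∫ ω, ((S ω : ℝ) - meanOf P S) ^ 2 ∂P)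

/-- The error at `k ∈ ℤ` in the Gaussian approximation of the point probabilities of `S`:
`|b √(2π) P(S = k) - exp (-(k - a)² / (2 b²))|`, with `a`, `b` the mean and standard deviation
of `S`. -/
noncomputable def localLimitError {Ω : Type*} [MeasurableSpace Ω] (P : Measure Ω) (S : Ω → ℕ)
    (k : ℤ) : ℝ :=
  |stdDevOf P S * Real.sqrt (2 * Real.pi) * P.real {ω | (S ω : ℤ) = k} -
    Real.exp (-((k : ℝ) - meanOf P S) ^ 2 / (2 * stdDevOf P S ^ 2))|

theorem Complex.norm_exp_sub_exp_le {z w : ℂ} (hz : z.re ≤ 0) (hw : w.re ≤ 0) :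
    ‖Complex.exp z - Complex.exp w‖ ≤ ‖z - w‖ := by
  have h := Convex.norm_image_sub_le_of_norm_deriv_le (𝕜 := ℂ) (f := Complex.exp) (C := 1)
    (s := {z : ℂ | z.re ≤ 0}) (x := w) (y := z) (fun x _ => Complex.differentiableAt_exp)
    (fun x hx => by
      rw [Complex.deriv_exp, Complex.norm_exp]
      exact Real.exp_le_one_iff.2 hx)
    (convex_halfSpace_re_le 0) hw hz
  simpa using h

theorem norm_exp_mul_I_sub_taylor_two_le {y B : ℝ} (hy : |y| ≤ B) :
    ‖Complex.exp (y * Complex.I) - (1 + y * Complex.I - y ^ 2 / 2)‖ ≤ |y| ^ 3 * Real.exp B := by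
  have h := Complex.norm_exp_sub_sum_le_norm_mul_exp (y * Complex.I) 3
  have hn : ‖(y : ℂ) * Complex.I‖ = |y| := by simp
  rw [hn] at h
  have hs : ∑ m ∈ Finset.range 3, ((y : ℂ) * Complex.I) ^ m / (m.factorial : ℂ)
      = 1 + y * Complex.I - y ^ 2 / 2 := by
    simp [Finset.sum_range_succ, mul_pow, Nat.factorial]
    ring
  rw [hs] at h
  exact h.trans (by gcongr)

theorem abs_one_sub_sub_exp_neg_le {u : ℝ} (hu : 0 ≤ u) : |1 - u - Real.exp (-u)| ≤ u ^ 2 := by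
  have h1 := Real.add_one_le_exp (-u)
  rcases le_total u 1 with h | h
  · have := Real.norm_exp_sub_one_sub_id_le (x := -u) (by rwa [norm_neg, Real.norm_of_nonneg hu])
    rw [Real.norm_eq_abs, Real.norm_eq_abs, sq_abs, neg_sq] at this
    rw [abs_sub_comm]
    convert this using 2
    ring
  · have h2 : Real.exp (-u) ≤ 1 := Real.exp_le_one_iff.2 (by linarith)
    rw [abs_le]
    constructor <;> nlinarith

/-- The characteristic function of `X` has a Gaussian upper bound on `[-π, π]`, and after centring
it agrees up to third order at the origin with that of a Gaussian with the same variance. -/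
structure GaussianCharFunBound {Ω : Type*} [MeasurableSpace Ω] (κ K : ℝ) (X : Ω → ℝ)
    (P : Measure Ω) : Prop where
  memLp : MemLp X 2 P
  norm_le : ∀ θ : ℝ, |θ| ≤ Real.pi →
    ‖charFun (P.map X) θ‖ ≤ Real.exp (-(κ * Var[X; P] * θ ^ 2))
  norm_sub_le : ∀ θ : ℝ, |θ| ≤ 1 →
    ‖charFun (P.map X) θ * Complex.exp (-(θ * (∫ ω, X ω ∂P) * Complex.I)) -
      Complex.exp (-(Var[X; P] * θ ^ 2 / 2))‖ ≤ K * Var[X; P] * |θ| ^ 3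

namespace GaussianCharFunBound

variable {Ω : Type*} [MeasurableSpace Ω] {P : Measure Ω}

theorem mono {κ κ' K K' : ℝ} {X : Ω → ℝ} (h : GaussianCharFunBound κ K X P) (hκ : κ' ≤ κ)
    (hK : K ≤ K') : GaussianCharFunBound κ' K' X P where
  memLp := h.memLp
  norm_le θ hθ := (h.norm_le θ hθ).trans <| by
    have := variance_nonneg X P
    gcongr
  norm_sub_le θ hθ := (h.norm_sub_le θ hθ).trans <| by
    have := variance_nonneg X P
    gcongr

variable [IsProbabilityMeasure P]

theorem zero (κ K : ℝ) : GaussianCharFunBound κ K (0 : Ω → ℝ) P where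
  memLp := MemLp.zero
  norm_le θ hθ := by
    have : IsProbabilityMeasure (P.map (0 : Ω → ℝ)) :=
      Measure.isProbabilityMeasure_map aemeasurable_const
    rw [variance_zero, mul_zero, zero_mul, neg_zero, Real.exp_zero]
    exact norm_charFun_le_one θ
  norm_sub_le θ hθ := by
    rw [variance_zero]
    simp [show (0 : Ω → ℝ) = fun _ => (0 : ℝ) from rfl, Measure.map_const]

theorem add {κ K : ℝ} {X Y : Ω → ℝ} (hX : GaussianCharFunBound κ K X P)
    (hY : GaussianCharFunBound κ K Y P) (h : IndepFun X Y P) :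
    GaussianCharFunBound κ K (X + Y) P := by
  have hc := h.charFun_map_add_eq_mul hX.memLp.aemeasurable hY.memLp.aemeasurable
  have hv := h.variance_add hX.memLp hY.memLp
  have hm : ∫ ω, (X + Y) ω ∂P = ∫ ω, X ω ∂P + ∫ ω, Y ω ∂P :=
    integral_add (hX.memLp.integrable one_le_two) (hY.memLp.integrable one_le_two)
  refine ⟨hX.memLp.add hY.memLp, fun θ hθ => ?_, fun θ hθ => ?_⟩
  · rw [hc, hv, Pi.mul_apply, norm_mul, show -(κ * (Var[X; P] + Var[Y; P]) * θ ^ 2) =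
      -(κ * Var[X; P] * θ ^ 2) + -(κ * Var[Y; P] * θ ^ 2) by ring, Real.exp_add]
    exact mul_le_mul (hX.norm_le θ hθ) (hY.norm_le θ hθ) (norm_nonneg _) (Real.exp_nonneg _)
  · rw [hc, hv, hm, Pi.mul_apply]
    have : IsProbabilityMeasure (P.map Y) := Measure.isProbabilityMeasure_map hY.memLp.aemeasurable
    have h1 := hX.norm_sub_le θ hθ
    have h2 := hY.norm_sub_le θ hθ
    push_cast
    rw [show -((θ : ℂ) * ((∫ ω, X ω ∂P : ℝ) + (∫ ω, Y ω ∂P : ℝ)) * Complex.I) =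
      -(θ * (∫ ω, X ω ∂P : ℝ) * Complex.I) + -(θ * (∫ ω, Y ω ∂P : ℝ) * Complex.I) by ring,
      Complex.exp_add, show -(((Var[X; P] : ℂ) + Var[Y; P]) * θ ^ 2 / 2) =
      -(Var[X; P] * θ ^ 2 / 2) + -(Var[Y; P] * θ ^ 2 / 2) by ring, Complex.exp_add]
    have h3 : ‖charFun (P.map Y) θ * Complex.exp (-(θ * (∫ ω, Y ω ∂P) * Complex.I))‖ ≤ 1 := by
      rw [norm_mul, show -((θ : ℂ) * (∫ ω, Y ω ∂P : ℝ) * Complex.I) =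
        ((-(θ * ∫ ω, Y ω ∂P) : ℝ) : ℂ) * Complex.I by push_cast; ring,
        Complex.norm_exp_ofReal_mul_I, mul_one]
      exact norm_charFun_le_one θ
    have h4 : ‖Complex.exp (-(Var[X; P] * θ ^ 2 / 2))‖ ≤ 1 := by
      rw [show -((Var[X; P] : ℂ) * θ ^ 2 / 2) = ((-(Var[X; P] * θ ^ 2 / 2) : ℝ) : ℂ) by
        push_cast; ring, Complex.norm_exp_ofReal, Real.exp_le_one_iff]
      have := variance_nonneg X P
      have : 0 ≤ Var[X; P] * θ ^ 2 / 2 := by positivity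
      linarith
    generalize Complex.exp (-(Var[X; P] * θ ^ 2 / 2)) = g₁ at *
    generalize Complex.exp (-(Var[Y; P] * θ ^ 2 / 2)) = g₂ at *
    generalize Complex.exp (-(θ * (∫ ω, X ω ∂P : ℝ) * Complex.I)) = e₁ at *
    generalize Complex.exp (-(θ * (∫ ω, Y ω ∂P : ℝ) * Complex.I)) = e₂ at *
    generalize charFun (P.map X) θ = f₁ at *
    generalize charFun (P.map Y) θ = f₂ at *
    calc ‖f₁ * f₂ * (e₁ * e₂) - g₁ * g₂‖
        = ‖(f₁ * e₁ - g₁) * (f₂ * e₂) + g₁ * (f₂ * e₂ - g₂)‖ := by congr 1; ring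
      _ ≤ ‖f₁ * e₁ - g₁‖ * ‖f₂ * e₂‖ + ‖g₁‖ * ‖f₂ * e₂ - g₂‖ := by
          refine (norm_add_le _ _).trans_eq ?_
          rw [norm_mul (f₁ * e₁ - g₁), norm_mul g₁]
      _ ≤ ‖f₁ * e₁ - g₁‖ * 1 + 1 * ‖f₂ * e₂ - g₂‖ := by gcongr
      _ ≤ K * (Var[X; P] + Var[Y; P]) * |θ| ^ 3 := by linarith

theorem finsetSum {ι : Type*} {κ K : ℝ} {X : ι → Ω → ℝ}
    (hX : ∀ i, GaussianCharFunBound κ K (X i) P) (h : iIndepFun X P) (s : Finset ι) :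
    GaussianCharFunBound κ K (∑ i ∈ s, X i) P := by
  classical
  induction s using Finset.induction_on with
  | empty => simpa using zero (P := P) κ K
  | insert i s hi ih =>
    rw [Finset.sum_insert hi]
    exact (hX i).add ih
      (h.indepFun_finsetSum_of_notMem₀ (fun j => (hX j).memLp.aemeasurable) hi).symm

end GaussianCharFunBound

theorem GaussianCharFunBound.of_hasLaw {Ω : Type*} [MeasurableSpace Ω] {P : Measure Ω}
    {κ K : ℝ} {X : Ω → ℕ} {μ : Measure ℕ} (hX : HasLaw X μ P)
    (h : GaussianCharFunBound κ K (Nat.cast : ℕ → ℝ) μ) :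
    GaussianCharFunBound κ K (fun ω => (X ω : ℝ)) P := by
  have hm : AEMeasurable (Nat.cast : ℕ → ℝ) μ := Measurable.of_discrete.aemeasurable
  have hlaw : P.map (fun ω => (X ω : ℝ)) = μ.map Nat.cast := by
    rw [← hX.map_eq, AEMeasurable.map_map_of_aemeasurable (by rwa [hX.map_eq]) hX.aemeasurable]
    rfl
  have hv : Var[fun ω => (X ω : ℝ); P] = Var[(Nat.cast : ℕ → ℝ); μ] := by
    rw [← hX.map_eq, variance_map (by rwa [hX.map_eq]) hX.aemeasurable]
    rfl
  have hi : ∫ ω, (X ω : ℝ) ∂P = ∫ n, (n : ℝ) ∂μ :=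
    hX.integral_comp (f := (Nat.cast : ℕ → ℝ)) hm.aestronglyMeasurable
  refine ⟨?_, fun θ hθ => ?_, fun θ hθ => ?_⟩
  · have := h.memLp
    rw [← hX.map_eq, memLp_map_measure_iff (by rw [hX.map_eq]; exact hm.aestronglyMeasurable)
      hX.aemeasurable] at this
    exact this
  · rw [hlaw, hv]
    exact h.norm_le θ hθ
  · rw [hlaw, hv, hi]
    exact h.norm_sub_le θ hθ

theorem charFun_map_natCast (μ : Measure ℕ) (θ : ℝ) :
    charFun (μ.map (Nat.cast : ℕ → ℝ)) θ = ∫ n : ℕ, Complex.exp (θ * n * Complex.I) ∂μ := by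
  rw [charFun_apply_real, integral_map Measurable.of_discrete.aemeasurable (by fun_prop)]
  simp

theorem Complex.norm_sq_sum_ofReal_mul_exp {ι : Type*} (s : Finset ι) (p x : ι → ℝ) :
    ‖∑ k ∈ s, (p k : ℂ) * Complex.exp (x k * Complex.I)‖ ^ 2 =
      ∑ k ∈ s, ∑ l ∈ s, p k * p l * Real.cos (x k - x l) := by
  have hre : (∑ k ∈ s, (p k : ℂ) * Complex.exp (x k * Complex.I)).re =
      ∑ k ∈ s, p k * Real.cos (x k) := by
    simp [Complex.re_sum, Complex.exp_ofReal_mul_I_re]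
  have him : (∑ k ∈ s, (p k : ℂ) * Complex.exp (x k * Complex.I)).im =
      ∑ k ∈ s, p k * Real.sin (x k) := by
    simp [Complex.im_sum, Complex.exp_ofReal_mul_I_im]
  rw [← Complex.normSq_eq_norm_sq, Complex.normSq_apply, hre, him, Finset.sum_mul_sum,
    Finset.sum_mul_sum, ← Finset.sum_add_distrib]
  refine Finset.sum_congr rfl fun k _ => ?_
  rw [← Finset.sum_add_distrib]
  refine Finset.sum_congr rfl fun l _ => ?_
  rw [Real.cos_sub]
  ring

/-- If every product of two weights is at most the sum of the products of neighbouring weights,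
then the variance controls the decay of the characteristic function. -/
theorem norm_sum_mul_exp_le_of_mul_le {c : ℕ} {p : ℕ → ℝ} (hp : ∀ k, 0 ≤ p k)
    (hsum : ∑ k ∈ Finset.range (c + 1), p k = 1)
    (hlc : ∀ k l, k < l → l ≤ c → p k * p l ≤ ∑ j ∈ Finset.range c, p j * p (j + 1))
    {v : ℝ} (hv : v = ∑ k ∈ Finset.range (c + 1), p k * (k : ℝ) ^ 2 -
      (∑ k ∈ Finset.range (c + 1), p k * (k : ℝ)) ^ 2) {θ : ℝ} (hθ : |θ| ≤ Real.pi) :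
    ‖∑ k ∈ Finset.range (c + 1), (p k : ℂ) * Complex.exp ((θ * k : ℝ) * Complex.I)‖ ≤
      Real.exp (-(2 / (Real.pi ^ 2 * (c + 1) ^ 4) * v * θ ^ 2)) := by
  set s := Finset.range (c + 1) with hs
  set D := ∑ j ∈ Finset.range c, p j * p (j + 1) with hD
  have hD0 : 0 ≤ D := Finset.sum_nonneg fun j _ => mul_nonneg (hp _) (hp _)
  have hvD : 2 * v ≤ (c + 1) ^ 4 * D := by
    have h1 : 2 * v = ∑ k ∈ s, ∑ l ∈ s, p k * p l * ((k : ℝ) - l) ^ 2 := by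
      have e : ∀ k l : ℕ, p k * p l * ((k : ℝ) - l) ^ 2 =
          (p k * (k : ℝ) ^ 2) * p l + p k * (p l * (l : ℝ) ^ 2) -
            2 * ((p k * k) * (p l * l)) := fun k l => by ring
      simp_rw [e, Finset.sum_sub_distrib, Finset.sum_add_distrib, ← Finset.mul_sum,
        ← Finset.sum_mul]
      rw [hsum, hv]
      ring
    have h2 : ∀ k ∈ s, ∀ l ∈ s, p k * p l * ((k : ℝ) - l) ^ 2 ≤ (c + 1) ^ 2 * D := by
      intro k hk l hl
      have hk' : (k : ℝ) ≤ c := by exact_mod_cast Finset.mem_range_succ_iff.1 hk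
      have hl' : (l : ℝ) ≤ c := by exact_mod_cast Finset.mem_range_succ_iff.1 hl
      have hk0 : (0 : ℝ) ≤ k := k.cast_nonneg
      have hl0 : (0 : ℝ) ≤ l := l.cast_nonneg
      have hsq : ((k : ℝ) - l) ^ 2 ≤ (c + 1) ^ 2 := sq_le_sq' (by linarith) (by linarith)
      rcases lt_trichotomy k l with h | h | h
      · rw [mul_comm]
        exact mul_le_mul hsq (hlc k l h (Finset.mem_range_succ_iff.1 hl))
          (mul_nonneg (hp _) (hp _)) (by positivity)
      · subst h
        rw [sub_self]
        have : 0 ≤ ((c : ℝ) + 1) ^ 2 * D := by positivity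
        simpa using this
      · rw [mul_comm, mul_comm (p k)]
        exact mul_le_mul hsq (hlc l k h (Finset.mem_range_succ_iff.1 hk))
          (mul_nonneg (hp _) (hp _)) (by positivity)
    rw [h1]
    refine (Finset.sum_le_sum fun k hk => Finset.sum_le_sum fun l hl => h2 k hk l hl).trans_eq ?_
    simp [hs]
    ring
  have hcos : 2 / Real.pi ^ 2 * θ ^ 2 ≤ 1 - Real.cos θ := by
    have := Real.cos_le_one_sub_mul_cos_sq hθ
    linarith
  have hnorm : ‖∑ k ∈ s, (p k : ℂ) * Complex.exp ((θ * k : ℝ) * Complex.I)‖ ^ 2 ≤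
      1 - D * (1 - Real.cos θ) := by
    have hone : (1 : ℝ) = ∑ k ∈ s, ∑ l ∈ s, p k * p l := by
      rw [← Finset.sum_mul_sum, hsum, one_mul]
    rw [Complex.norm_sq_sum_ofReal_mul_exp, le_sub_comm]
    nth_rewrite 2 [hone]
    rw [← Finset.sum_sub_distrib]
    simp_rw [← Finset.sum_sub_distrib]
    have hnn : ∀ k l : ℕ, 0 ≤ p k * p l - p k * p l * Real.cos (θ * k - θ * l) := fun k l => by
      have h1 := mul_nonneg (hp k) (hp l)
      have h2 := Real.cos_le_one (θ * k - θ * l)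
      nlinarith
    rw [hs, Finset.sum_range_succ, hD, Finset.sum_mul]
    refine le_add_of_le_of_nonneg (Finset.sum_le_sum fun k hk => ?_)
      (Finset.sum_nonneg fun l _ => hnn _ _)
    refine le_trans (le_of_eq ?_) (Finset.single_le_sum (f := fun l : ℕ =>
      p k * p l - p k * p l * Real.cos (θ * k - θ * l)) (fun l _ => hnn k l)
      (Finset.mem_range_succ_iff.2 (Finset.mem_range.1 hk)))
    have : θ * (k : ℝ) - θ * ((k + 1 : ℕ) : ℝ) = -θ := by push_cast; ring
    rw [this, Real.cos_neg]
    ring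
  have hle : 1 - D * (1 - Real.cos θ) ≤
      Real.exp (-(2 / (Real.pi ^ 2 * (c + 1) ^ 4) * v * θ ^ 2)) ^ 2 := by
    rw [← Real.exp_nat_mul]
    refine le_trans ?_ (Real.add_one_le_exp _)
    have h1 : D * (2 / Real.pi ^ 2 * θ ^ 2) ≤ D * (1 - Real.cos θ) := by gcongr
    have h2 : 2 * (2 / (Real.pi ^ 2 * (c + 1) ^ 4) * v * θ ^ 2) =
        2 * v / (c + 1) ^ 4 * (2 / Real.pi ^ 2 * θ ^ 2) := by
      field_simp
    have h3 : 2 * v / (c + 1) ^ 4 ≤ D := by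
      rw [div_le_iff₀ (by positivity)]
      linarith
    have h4 : 2 * v / (c + 1) ^ 4 * (2 / Real.pi ^ 2 * θ ^ 2) ≤ D * (2 / Real.pi ^ 2 * θ ^ 2) := by
      gcongr
    push_cast
    linarith
  exact le_of_sq_le_sq (hnorm.trans hle) (Real.exp_nonneg _)

/-- Third order comparison of the centred characteristic function with the Gaussian one, for a
random variable taking values within distance `C` of its mean. -/
theorem norm_charFun_mul_exp_sub_gaussian_le_of_ae_abs_le {Ω : Type*} [MeasurableSpace Ω] {P : Measure Ω}
    [IsProbabilityMeasure P] {X : Ω → ℝ} (hX : AEMeasurable X P) {C : ℝ} (hC : 0 ≤ C)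
    (hb : ∀ᵐ ω ∂P, |X ω - ∫ ω, X ω ∂P| ≤ C) {θ : ℝ} (hθ : |θ| ≤ 1) :
    ‖charFun (P.map X) θ * Complex.exp (-(θ * (∫ ω, X ω ∂P) * Complex.I)) -
      Complex.exp (-(Var[X; P] * θ ^ 2 / 2))‖ ≤
      (C * Real.exp C + C ^ 2) * Var[X; P] * |θ| ^ 3 := by
  set m := ∫ ω, X ω ∂P with hm
  set v := Var[X; P] with hv
  have hYm : AEMeasurable (fun ω => X ω - m) P := hX.sub_const m
  have hbn : ∀ᵐ ω ∂P, ‖X ω - m‖ ≤ C := hb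
  have hYi : Integrable (fun ω => X ω - m) P := .of_bound hYm.aestronglyMeasurable C hbn
  have hY2 : Integrable (fun ω => (X ω - m) ^ 2) P := by
    refine .of_bound (hYm.pow_const 2).aestronglyMeasurable (C ^ 2) ?_
    filter_upwards [hbn] with ω hω
    rw [norm_pow]
    gcongr
  have hveq : v = ∫ ω, (X ω - m) ^ 2 ∂P := variance_eq_integral hX
  have hv0 : 0 ≤ v := variance_nonneg X P
  have hXi : Integrable X P :=
    (hYi.add (integrable_const m)).congr (ae_of_all _ fun ω => by simp)
  have hY0 : ∫ ω, (X ω - m) ∂P = 0 := by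
    rw [integral_sub hXi (integrable_const m)]
    simp [hm]
  have hvC : v ≤ C ^ 2 := by
    rw [hveq]
    have : ∫ ω, (X ω - m) ^ 2 ∂P ≤ ∫ _, C ^ 2 ∂P := by
      refine integral_mono_ae hY2 (integrable_const _) ?_
      filter_upwards [hb] with ω hω
      rw [← sq_abs]
      gcongr
    simpa using this
  have hcf : charFun (P.map X) θ * Complex.exp (-(θ * m * Complex.I)) =
      ∫ ω, Complex.exp ((θ * (X ω - m) : ℝ) * Complex.I) ∂P := by
    rw [charFun_apply_real, integral_map hX (by fun_prop), ← integral_mul_const]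
    refine integral_congr_ae (ae_of_all _ fun ω => ?_)
    simp only
    rw [← Complex.exp_add]
    congr 1
    push_cast
    ring
  have hei : Integrable (fun ω => Complex.exp ((θ * (X ω - m) : ℝ) * Complex.I)) P := by
    refine .of_bound (C := 1) ?_ (ae_of_all _ fun ω => ?_)
    · exact AEMeasurable.aestronglyMeasurable (by fun_prop)
    · rw [Complex.norm_exp_ofReal_mul_I]
  have hYc : Integrable (fun ω => ((θ * (X ω - m) : ℝ) : ℂ) * Complex.I) P :=
    ((hYi.const_mul θ).ofReal).mul_const _
  have hY2c : Integrable (fun ω => ((θ * (X ω - m) : ℝ) : ℂ) ^ 2 / 2) P := by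
    have : Integrable (fun ω => (((θ * (X ω - m)) ^ 2 / 2 : ℝ) : ℂ)) P := by
      refine Integrable.ofReal ?_
      simp_rw [mul_pow]
      exact (hY2.const_mul _).div_const _
    refine this.congr (ae_of_all _ fun ω => ?_)
    push_cast
    rfl
  have h1c : Integrable (fun ω => 1 + ((θ * (X ω - m) : ℝ) : ℂ) * Complex.I) P :=
    (integrable_const _).add hYc
  have hpc : Integrable (fun ω => 1 + ((θ * (X ω - m) : ℝ) : ℂ) * Complex.I -
      ((θ * (X ω - m) : ℝ) : ℂ) ^ 2 / 2) P := h1c.sub hY2c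
  have hpoly : ∫ ω, (1 + ((θ * (X ω - m) : ℝ) : ℂ) * Complex.I -
      ((θ * (X ω - m) : ℝ) : ℂ) ^ 2 / 2) ∂P = ((1 - v * θ ^ 2 / 2 : ℝ) : ℂ) := by
    rw [integral_sub h1c hY2c,
      integral_add (integrable_const _) hYc, integral_mul_const, integral_complex_ofReal,
      integral_const_mul, hY0]
    have : ∫ ω, ((θ * (X ω - m) : ℝ) : ℂ) ^ 2 / 2 ∂P = ((v * θ ^ 2 / 2 : ℝ) : ℂ) := by
      have : ∀ ω, ((θ * (X ω - m) : ℝ) : ℂ) ^ 2 / 2 =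
          ((θ ^ 2 * (X ω - m) ^ 2 / 2 : ℝ) : ℂ) := fun ω => by push_cast; ring
      simp_rw [this]
      rw [integral_complex_ofReal, integral_div, integral_const_mul, ← hveq]
      congr 1
      ring
    rw [this]
    simp
  have h1 : ‖∫ ω, Complex.exp ((θ * (X ω - m) : ℝ) * Complex.I) ∂P -
      ((1 - v * θ ^ 2 / 2 : ℝ) : ℂ)‖ ≤ C * Real.exp C * v * |θ| ^ 3 := by
    rw [← hpoly, ← integral_sub hei hpc]
    have hbd : ∀ᵐ ω ∂P, ‖Complex.exp ((θ * (X ω - m) : ℝ) * Complex.I) -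
        (1 + ((θ * (X ω - m) : ℝ) : ℂ) * Complex.I - ((θ * (X ω - m) : ℝ) : ℂ) ^ 2 / 2)‖ ≤
        C * Real.exp C * |θ| ^ 3 * (X ω - m) ^ 2 := by
      filter_upwards [hb] with ω hω
      have hθX : |θ * (X ω - m)| ≤ C := by
        rw [abs_mul]
        calc |θ| * |X ω - m| ≤ 1 * C := by gcongr
          _ = C := one_mul C
      refine (norm_exp_mul_I_sub_taylor_two_le hθX).trans ?_
      rw [abs_mul, mul_pow, ← sq_abs (X ω - m)]
      calc |θ| ^ 3 * |X ω - m| ^ 3 * Real.exp C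
          = Real.exp C * |θ| ^ 3 * |X ω - m| ^ 2 * |X ω - m| := by ring
        _ ≤ Real.exp C * |θ| ^ 3 * |X ω - m| ^ 2 * C := by gcongr
        _ = _ := by ring
    refine (norm_integral_le_of_norm_le (hY2.const_mul _) hbd).trans_eq ?_
    rw [integral_const_mul, ← hveq]
    ring
  have h2 : ‖((1 - v * θ ^ 2 / 2 : ℝ) : ℂ) - Complex.exp (-(v * θ ^ 2 / 2))‖ ≤
      C ^ 2 * v * |θ| ^ 3 := by
    rw [show -((v : ℂ) * θ ^ 2 / 2) = ((-(v * θ ^ 2 / 2) : ℝ) : ℂ) by push_cast; ring,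
      ← Complex.ofReal_exp, ← Complex.ofReal_sub, Complex.norm_real, Real.norm_eq_abs]
    refine (abs_one_sub_sub_exp_neg_le (by positivity)).trans ?_
    have h4 : θ ^ 4 ≤ |θ| ^ 3 := by
      rw [← Even.pow_abs (by decide : Even 4)]
      exact pow_le_pow_of_le_one (abs_nonneg _) hθ (by norm_num)
    calc (v * θ ^ 2 / 2) ^ 2 = v * v * θ ^ 4 / 4 := by ring
      _ ≤ v * v * θ ^ 4 := div_le_self (by positivity) (by norm_num)
      _ ≤ C ^ 2 * v * |θ| ^ 3 := by gcongr
  rw [hcf]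
  refine (norm_sub_le_norm_sub_add_norm_sub _ ((1 - v * θ ^ 2 / 2 : ℝ) : ℂ) _).trans ?_
  linarith

theorem sum_range_succ_pow_pos (ρ : ℝ≥0) (c : ℕ) :
    0 < ∑ h ∈ Finset.range (c + 1), (ρ : ℝ) ^ h := by
  rw [Finset.sum_range_succ']
  have : 0 ≤ ∑ h ∈ Finset.range c, (ρ : ℝ) ^ (h + 1) := Finset.sum_nonneg fun _ _ => by positivity
  simp only [pow_zero]
  linarith

theorem integral_truncGeometricMeasure {E : Type*} [NormedAddCommGroup E] [NormedSpace ℝ E]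
    [CompleteSpace E] (ρ : ℝ≥0) (c : ℕ) (f : ℕ → E) :
    ∫ n, f n ∂truncGeometricMeasure ρ c = ∑ k ∈ Finset.range (c + 1),
      ((ρ : ℝ) ^ k / ∑ h ∈ Finset.range (c + 1), (ρ : ℝ) ^ h) • f k := by
  have hpos := sum_range_succ_pow_pos ρ c
  rw [truncGeometricMeasure, integral_finsetSum_measure fun i _ =>
    (integrable_dirac (by simp)).smul_measure ENNReal.ofReal_ne_top]
  refine Finset.sum_congr rfl fun k _ => ?_
  rw [integral_smul_measure, integral_dirac, ENNReal.toReal_ofReal (by positivity)]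

theorem ae_le_truncGeometricMeasure (ρ : ℝ≥0) (c : ℕ) :
    ∀ᵐ n ∂truncGeometricMeasure ρ c, n ≤ c := by
  rw [ae_iff_of_countable]
  intro n hn
  rw [truncGeometricMeasure_singleton] at hn
  by_contra h
  exact hn (if_neg h)

theorem truncGeometric_mul_le_sum (ρ : ℝ≥0) (c : ℕ) {k l : ℕ} (hkl : k < l) (hl : l ≤ c) :
    (ρ : ℝ) ^ k * (ρ : ℝ) ^ l ≤ ∑ j ∈ Finset.range c, (ρ : ℝ) ^ j * (ρ : ℝ) ^ (j + 1) := by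
  have hnn : ∀ j ∈ Finset.range c, 0 ≤ (ρ : ℝ) ^ j * (ρ : ℝ) ^ (j + 1) := fun _ _ => by positivity
  rcases le_total (ρ : ℝ) 1 with h | h
  · refine le_trans ?_ (Finset.single_le_sum hnn (Finset.mem_range.2 (hkl.trans_le hl)))
    gcongr ?_ * ?_
    exact pow_le_pow_of_le_one ρ.2 h hkl
  · obtain ⟨l, rfl⟩ : ∃ l', l = l' + 1 := ⟨l - 1, by omega⟩
    refine le_trans ?_ (Finset.single_le_sum hnn (Finset.mem_range.2 hl))
    gcongr ?_ * ?_
    exact pow_le_pow_right₀ h (Nat.lt_succ_iff.1 hkl)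

theorem gaussianCharFunBound_truncGeometric (ρ : ℝ≥0) (c : ℕ) :
    GaussianCharFunBound (2 / (Real.pi ^ 2 * (c + 1) ^ 4)) (c * Real.exp c + c ^ 2)
      (Nat.cast : ℕ → ℝ) (truncGeometricMeasure ρ c) := by
  set μ := truncGeometricMeasure ρ c with hμ
  have hm : AEMeasurable (Nat.cast : ℕ → ℝ) μ := Measurable.of_discrete.aemeasurable
  have hle : ∀ᵐ n : ℕ ∂μ, ‖(n : ℝ)‖ ≤ c := by
    filter_upwards [ae_le_truncGeometricMeasure ρ c] with n hn
    simpa using hn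
  have hLp : MemLp (Nat.cast : ℕ → ℝ) 2 μ := .of_bound hm.aestronglyMeasurable c hle
  have hint : Integrable (Nat.cast : ℕ → ℝ) μ := hLp.integrable one_le_two
  have hpos := sum_range_succ_pow_pos ρ c
  set Z := ∑ h ∈ Finset.range (c + 1), (ρ : ℝ) ^ h with hZ
  refine ⟨hLp, fun θ hθ => ?_, fun θ hθ => ?_⟩
  · have hv := variance_eq_sub hLp
    have hsq : ∫ n : ℕ, ((Nat.cast : ℕ → ℝ) ^ 2) n ∂μ =
        ∑ k ∈ Finset.range (c + 1), ((ρ : ℝ) ^ k / Z) * (k : ℝ) ^ 2 :=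
      integral_truncGeometricMeasure ρ c _
    have hmean : ∫ n : ℕ, (n : ℝ) ∂μ = ∑ k ∈ Finset.range (c + 1), ((ρ : ℝ) ^ k / Z) * (k : ℝ) :=
      integral_truncGeometricMeasure ρ c _
    rw [hsq, hmean] at hv
    have h := norm_sum_mul_exp_le_of_mul_le (c := c) (p := fun k => (ρ : ℝ) ^ k / Z)
      (fun k => by positivity) (by rw [← Finset.sum_div, div_self hpos.ne']) (fun k l hkl hl => by
        have := truncGeometric_mul_le_sum ρ c hkl hl
        simp_rw [div_mul_div_comm, ← Finset.sum_div]
        gcongr) hv hθ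
    refine le_of_eq_of_le ?_ h
    rw [charFun_map_natCast, integral_truncGeometricMeasure]
    simp only [Complex.real_smul]
    rw [hZ]
    push_cast
    rfl
  · refine norm_charFun_mul_exp_sub_gaussian_le_of_ae_abs_le hm c.cast_nonneg ?_ hθ
    have h0 : 0 ≤ ∫ n : ℕ, (n : ℝ) ∂μ := integral_nonneg fun n => n.cast_nonneg
    have h1 : ∫ n : ℕ, (n : ℝ) ∂μ ≤ c := by
      have : ∫ n : ℕ, (n : ℝ) ∂μ ≤ ∫ _, (c : ℝ) ∂μ := by
        refine integral_mono_ae hint (integrable_const _) ?_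
        filter_upwards [hle] with n hn
        exact (le_abs_self _).trans hn
      simpa using this
    filter_upwards [hle] with n hn
    have h2 : (n : ℝ) ≤ c := (le_abs_self _).trans hn
    have h3 : (0 : ℝ) ≤ n := n.cast_nonneg
    rw [abs_le]
    constructor <;> linarith

section Poisson

open Nat in
theorem hasSum_poisson_mul_cast (r : ℝ≥0) :
    HasSum (fun n : ℕ => Real.exp (-r) * (r : ℝ) ^ n / n ! * n) r := by
  rw [← hasSum_nat_add_iff' 1]
  have h := (hasSum_one_poissonMeasure r).mul_left (r : ℝ)
  simp only [Finset.range_one, Finset.sum_singleton, Nat.cast_zero, mul_zero, sub_zero]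
  rw [mul_one] at h
  refine h.congr_fun fun n => ?_
  rw [Nat.factorial_succ]
  push_cast
  have : (n ! : ℝ) ≠ 0 := by positivity
  field_simp
  ring

open Nat in
theorem hasSum_poisson_mul_cast_sq (r : ℝ≥0) :
    HasSum (fun n : ℕ => Real.exp (-r) * (r : ℝ) ^ n / n ! * (n : ℝ) ^ 2) ((r : ℝ) ^ 2 + r) := by
  rw [← hasSum_nat_add_iff' 1]
  have h := ((hasSum_poisson_mul_cast r).mul_left (r : ℝ)).add
    ((hasSum_one_poissonMeasure r).mul_left (r : ℝ))
  simp only [Finset.range_one, Finset.sum_singleton, Nat.cast_zero, ne_eq, OfNat.ofNat_ne_zero,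
    not_false_eq_true, zero_pow, mul_zero, sub_zero]
  rw [mul_one, ← sq] at h
  refine h.congr_fun fun n => ?_
  rw [Nat.factorial_succ]
  push_cast
  have : (n ! : ℝ) ≠ 0 := by positivity
  field_simp
  ring

theorem memLp_natCast_poissonMeasure (r : ℝ≥0) :
    MemLp (Nat.cast : ℕ → ℝ) 2 (poissonMeasure r) := by
  rw [memLp_two_iff_integrable_sq Measurable.of_discrete.aestronglyMeasurable,
    integrable_poissonMeasure_iff]
  simpa using (hasSum_poisson_mul_cast_sq r).summable

theorem integral_natCast_poissonMeasure (r : ℝ≥0) : ∫ n : ℕ, (n : ℝ) ∂poissonMeasure r = r := by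
  rw [integral_poissonMeasure]
  exact (hasSum_poisson_mul_cast r).tsum_eq

theorem variance_natCast_poissonMeasure (r : ℝ≥0) :
    Var[(Nat.cast : ℕ → ℝ); poissonMeasure r] = r := by
  rw [variance_eq_sub (memLp_natCast_poissonMeasure r), integral_natCast_poissonMeasure,
    integral_poissonMeasure]
  have := (hasSum_poisson_mul_cast_sq r).tsum_eq
  simp only [smul_eq_mul, Pi.pow_apply]
  rw [this]
  ring

theorem gaussianCharFunBound_poisson (r : ℝ≥0) :
    GaussianCharFunBound (2 / Real.pi ^ 2) (Real.exp 1) (Nat.cast : ℕ → ℝ) (poissonMeasure r) := by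
  refine ⟨memLp_natCast_poissonMeasure r, fun θ hθ => ?_, fun θ hθ => ?_⟩
  · rw [charFun_map_cast_poissonMeasure, variance_natCast_poissonMeasure, Complex.norm_exp,
      Complex.re_ofReal_mul, Complex.sub_re, Complex.exp_ofReal_mul_I_re, Complex.one_re]
    have h := mul_le_mul_of_nonneg_left (Real.cos_le_one_sub_mul_cos_sq hθ) r.2
    change (r : ℝ) * _ ≤ (r : ℝ) * _ at h
    gcongr
    linarith
  · rw [charFun_map_cast_poissonMeasure, variance_natCast_poissonMeasure,
      integral_natCast_poissonMeasure, ← Complex.exp_add]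
    have hr : (0 : ℝ) ≤ r := r.2
    refine (Complex.norm_exp_sub_exp_le ?_ ?_).trans ?_
    · simp only [Complex.add_re, Complex.re_ofReal_mul, Complex.sub_re,
        Complex.exp_ofReal_mul_I_re, Complex.one_re, Complex.neg_re]
      have := mul_nonneg hr (sub_nonneg.2 (Real.cos_le_one θ))
      rw [show ((θ : ℂ) * ((r : ℝ) : ℂ) * Complex.I).re = 0 by simp]
      linarith
    · rw [show -(((r : ℝ) : ℂ) * (θ : ℂ) ^ 2 / 2) = ((-(r * θ ^ 2 / 2) : ℝ) : ℂ) by push_cast; rfl,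
        Complex.ofReal_re, neg_nonpos]
      positivity
    · have h := norm_exp_mul_I_sub_taylor_two_le hθ
      rw [show ((r : ℝ) : ℂ) * (Complex.exp (θ * Complex.I) - 1) +
        -(θ * ((r : ℝ) : ℂ) * Complex.I) - -(((r : ℝ) : ℂ) * θ ^ 2 / 2) = ((r : ℝ) : ℂ) *
        (Complex.exp (θ * Complex.I) - (1 + θ * Complex.I - θ ^ 2 / 2)) by ring, norm_mul,
        Complex.norm_real, Real.norm_of_nonneg hr]
      refine (mul_le_mul_of_nonneg_left h hr).trans_eq ?_
      ring

end Poisson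

theorem integral_exp_int_mul_I (m : ℤ) :
    ∫ θ in (-Real.pi)..Real.pi, Complex.exp (θ * m * Complex.I) =
      if m = 0 then 2 * (Real.pi : ℂ) else 0 := by
  split_ifs with h
  · subst h
    simp
    ring
  · have hc : (m : ℂ) * Complex.I ≠ 0 := mul_ne_zero (by exact_mod_cast h) Complex.I_ne_zero
    have he : ∀ θ : ℝ, Complex.exp (θ * m * Complex.I) = Complex.exp (m * Complex.I * θ) :=
      fun θ => by congr 1; ring
    simp_rw [he]
    rw [integral_exp_mul_complex hc, div_eq_zero_iff, sub_eq_zero]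
    refine Or.inl (Complex.exp_eq_exp_iff_exists_int.2 ⟨m, ?_⟩)
    push_cast
    ring

theorem integral_charFun_mul_exp_eq (ν : Measure ℕ) [IsProbabilityMeasure ν] (k : ℤ) :
    ∫ θ in (-Real.pi)..Real.pi,
      charFun (ν.map (Nat.cast : ℕ → ℝ)) θ * Complex.exp (-(θ * k * Complex.I)) =
      2 * Real.pi * ν.real {n | (n : ℤ) = k} := by
  have hcf : ∀ θ : ℝ, charFun (ν.map (Nat.cast : ℕ → ℝ)) θ * Complex.exp (-(θ * k * Complex.I)) =
      ∫ n : ℕ, Complex.exp (θ * ((n - k : ℤ) : ℂ) * Complex.I) ∂ν := fun θ => by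
    rw [charFun_map_natCast, ← integral_mul_const]
    refine integral_congr_ae (ae_of_all _ fun n => ?_)
    simp only
    rw [← Complex.exp_add]
    congr 1
    push_cast
    ring
  simp_rw [hcf]
  rw [intervalIntegral.integral_of_le (by linarith [Real.pi_pos]), integral_integral_swap]
  · simp_rw [← intervalIntegral.integral_of_le (neg_le_self Real.pi_pos.le),
      integral_exp_int_mul_I, sub_eq_zero]
    have : (fun n : ℕ => if (n : ℤ) = k then 2 * (Real.pi : ℂ) else 0) =
        Set.indicator {n : ℕ | (n : ℤ) = k} fun _ => 2 * (Real.pi : ℂ) := by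
      ext n
      simp [Set.indicator_apply]
    rw [this, integral_indicator_const _ (MeasurableSet.of_discrete), Complex.real_smul]
    ring
  · refine .of_bound (C := 1) ?_ (ae_of_all _ fun x => ?_)
    · have : Measurable fun n : ℕ => (((n : ℤ) - k : ℤ) : ℂ) := .of_discrete
      refine Measurable.aestronglyMeasurable ?_
      simp only [Function.uncurry_def]
      exact Complex.measurable_exp.comp (((Complex.measurable_ofReal.comp measurable_fst).mul
        (this.comp measurable_snd)).mul_const _)
    · simp only [Function.uncurry_def]
      rw [show ((x.1 : ℂ) * ((x.2 - k : ℤ) : ℂ) * Complex.I) =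
        ((x.1 * ((x.2 - k : ℤ) : ℝ) : ℝ) : ℂ) * Complex.I by push_cast; ring,
        Complex.norm_exp_ofReal_mul_I]

theorem integral_exp_mul_exp_neg_sq_div_two (x : ℝ) :
    ∫ t : ℝ, Complex.exp (-(t * x * Complex.I)) * Complex.exp (-(t ^ 2 / 2)) =
      Real.sqrt (2 * Real.pi) * Real.exp (-x ^ 2 / 2) := by
  have h := fourierIntegral_gaussian (b := 1 / 2) (by norm_num) (-x : ℂ)
  have e : ∀ t : ℝ, Complex.exp (-(t * x * Complex.I)) * Complex.exp (-((t : ℂ) ^ 2 / 2)) =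
      Complex.exp (Complex.I * (-x) * t) * Complex.exp (-(1 / 2) * (t : ℂ) ^ 2) := fun t => by
    congr 2 <;> ring
  simp_rw [e]
  rw [h]
  congr 1
  · rw [Real.sqrt_eq_rpow, Complex.ofReal_cpow (by positivity)]
    push_cast
    congr 1
    ring
  · push_cast
    congr 1
    ring

/-- The difference between the rescaled centred characteristic function, cut off at `π b`, and the
standard Gaussian one. -/
noncomputable def charFunDefect (φ : ℝ → ℂ) (a b t : ℝ) : ℂ :=
  Set.indicator (Set.Ioc (-(Real.pi * b)) (Real.pi * b))
    (fun t => φ (t / b) * Complex.exp (-((t / b : ℝ) * a * Complex.I))) t -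
    Complex.exp (-(t ^ 2 / 2))

theorem measurable_charFunDefect {φ : ℝ → ℂ} (hφ : Measurable φ) (a b : ℝ) :
    Measurable (charFunDefect φ a b) := by
  unfold charFunDefect
  refine Measurable.sub (Measurable.indicator ?_ measurableSet_Ioc) (by fun_prop)
  fun_prop

theorem integrable_exp_neg_of_mul_sq {κ : ℝ} (hκ : 0 < κ) :
    Integrable fun t : ℝ => Real.exp (-(κ * t ^ 2)) := by
  simpa [neg_mul] using integrable_exp_neg_mul_sq hκ

theorem localLimitError_le {Ω : Type*} [MeasurableSpace Ω] {P : Measure Ω} [IsProbabilityMeasure P]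
    {S : Ω → ℕ} (hS : AEMeasurable S P) (hb : 0 < stdDevOf P S) (k : ℤ) :
    localLimitError P S k ≤ (Real.sqrt (2 * Real.pi))⁻¹ * ∫ t : ℝ,
      ‖charFunDefect (charFun (P.map fun ω => (S ω : ℝ))) (meanOf P S) (stdDevOf P S) t‖ := by
  set b := stdDevOf P S with hb'
  set a := meanOf P S with ha
  set φ := charFun (P.map fun ω => (S ω : ℝ)) with hφ
  have : IsProbabilityMeasure (P.map S) := Measure.isProbabilityMeasure_map hS
  have hSr : AEMeasurable (fun ω => (S ω : ℝ)) P :=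
    Measurable.of_discrete.comp_aemeasurable hS
  have : IsProbabilityMeasure (P.map fun ω => (S ω : ℝ)) := Measure.isProbabilityMeasure_map hSr
  have hmap : P.map (fun ω => (S ω : ℝ)) = (P.map S).map (Nat.cast : ℕ → ℝ) := by
    rw [AEMeasurable.map_map_of_aemeasurable Measurable.of_discrete.aemeasurable hS]
    rfl
  have hprob : P.real {ω | (S ω : ℤ) = k} = (P.map S).real {n | (n : ℤ) = k} := by
    rw [map_measureReal_apply_of_aemeasurable hS .of_discrete]
    rfl
  set f : ℝ → ℂ := Set.indicator (Set.Ioc (-(Real.pi * b)) (Real.pi * b))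
    (fun t => φ (t / b) * Complex.exp (-((t / b : ℝ) * a * Complex.I))) with hf
  set x := (k - a) / b with hx
  have hle : -(Real.pi * b) ≤ Real.pi * b := by
    have := mul_pos Real.pi_pos hb
    linarith
  have hnormexp : ∀ y : ℝ, ‖Complex.exp (-((y : ℂ) * Complex.I))‖ = 1 := fun y => by
    rw [← neg_mul, ← Complex.ofReal_neg, Complex.norm_exp_ofReal_mul_I]
  have hnormx : ∀ t : ℝ, ‖Complex.exp (-((t : ℂ) * x * Complex.I))‖ = 1 := fun t => by
    simpa using hnormexp (t * x)
  have hfi : Integrable f := by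
    rw [hf, integrable_indicator_iff measurableSet_Ioc]
    refine Measure.integrableOn_of_bounded (M := 1) (by simp) ?_ (ae_of_all _ fun t => ?_)
    · exact Measurable.aestronglyMeasurable (by fun_prop)
    · rw [norm_mul, ← Complex.ofReal_mul, hnormexp, mul_one]
      exact norm_charFun_le_one _
  have hgi : Integrable fun t : ℝ => Complex.exp (-((t : ℂ) ^ 2 / 2)) := by
    refine (integrable_exp_neg_of_mul_sq (κ := 1 / 2) (by norm_num)).ofReal.congr
      (ae_of_all _ fun t => ?_)
    beta_reduce
    rw [show -((t : ℂ) ^ 2 / 2) = ((-(1 / 2 * t ^ 2) : ℝ) : ℂ) by push_cast; ring]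
    exact Complex.ofReal_exp _
  have hem : AEStronglyMeasurable (fun t : ℝ => Complex.exp (-((t : ℂ) * x * Complex.I))) :=
    Measurable.aestronglyMeasurable (by fun_prop)
  have h1 : ∫ t : ℝ, Complex.exp (-(t * x * Complex.I)) * f t =
      b * (2 * Real.pi * P.real {ω | (S ω : ℤ) = k}) := by
    rw [hprob, ← integral_charFun_mul_exp_eq, ← hmap]
    have e : (fun t : ℝ => Complex.exp (-(t * x * Complex.I)) * f t) =
        Set.indicator (Set.Ioc (-(Real.pi * b)) (Real.pi * b)) (fun t : ℝ =>
          φ (t / b) * Complex.exp (-((t / b : ℝ) * k * Complex.I))) := by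
      ext t
      simp only [hf, Set.indicator_apply]
      split_ifs
      · rw [mul_left_comm, ← Complex.exp_add]
        congr 2
        rw [hx]
        push_cast
        have : (b : ℂ) ≠ 0 := by exact_mod_cast hb.ne'
        field_simp
        ring
      · rw [mul_zero]
    rw [e, integral_indicator measurableSet_Ioc, ← intervalIntegral.integral_of_le hle,
      intervalIntegral.integral_comp_div (fun θ : ℝ => φ θ * Complex.exp (-(θ * k * Complex.I)))
        hb.ne', Complex.real_smul, neg_div, mul_div_cancel_right₀ _ hb.ne']
  have h2 := integral_exp_mul_exp_neg_sq_div_two x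
  have hs : (0 : ℝ) < Real.sqrt (2 * Real.pi) := Real.sqrt_pos.2 (by positivity)
  have hss : Real.sqrt (2 * Real.pi) * Real.sqrt (2 * Real.pi) = 2 * Real.pi :=
    Real.mul_self_sqrt (by positivity)
  have hexp : -((k : ℝ) - a) ^ 2 / (2 * b ^ 2) = -x ^ 2 / 2 := by
    rw [hx]
    field_simp
  have h3 : ∫ t : ℝ, Complex.exp (-(t * x * Complex.I)) * charFunDefect φ a b t =
      ((Real.sqrt (2 * Real.pi) * (b * Real.sqrt (2 * Real.pi) * P.real {ω | (S ω : ℤ) = k} -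
        Real.exp (-x ^ 2 / 2)) : ℝ) : ℂ) := by
    have e : ∀ t : ℝ, Complex.exp (-(t * x * Complex.I)) * charFunDefect φ a b t =
        Complex.exp (-(t * x * Complex.I)) * f t -
          Complex.exp (-(t * x * Complex.I)) * Complex.exp (-((t : ℂ) ^ 2 / 2)) := fun t =>
      mul_sub _ _ _
    simp_rw [e]
    rw [integral_sub (hfi.bdd_mul hem (ae_of_all _ fun t => (hnormx t).le))
      (hgi.bdd_mul hem (ae_of_all _ fun t => (hnormx t).le)), h1, h2]
    have hss' : (Real.sqrt (2 * Real.pi) : ℂ) * Real.sqrt (2 * Real.pi) = 2 * Real.pi := by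
      exact_mod_cast hss
    rw [Complex.ofReal_mul, Complex.ofReal_sub, Complex.ofReal_mul, Complex.ofReal_mul]
    linear_combination (-(b * P.real {ω | (S ω : ℤ) = k}) : ℂ) * hss'
  have h4 : Real.sqrt (2 * Real.pi) * localLimitError P S k =
      ‖∫ t : ℝ, Complex.exp (-(t * x * Complex.I)) * charFunDefect φ a b t‖ := by
    rw [h3, Complex.norm_real, Real.norm_eq_abs, abs_mul, abs_of_pos hs, localLimitError, ← hb',
      ← ha, hexp]
  rw [← div_eq_inv_mul, le_div_iff₀' hs, h4]
  refine (norm_integral_le_integral_norm _).trans_eq ?_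
  simp_rw [norm_mul, hnormx, one_mul]

theorem bddAbove_range_localLimitError {Ω : Type*} [MeasurableSpace Ω] (P : Measure Ω)
    [IsProbabilityMeasure P] (S : Ω → ℕ) : BddAbove (Set.range (localLimitError P S)) := by
  have hb : 0 ≤ stdDevOf P S := Real.sqrt_nonneg _
  refine ⟨stdDevOf P S * Real.sqrt (2 * Real.pi) + 1, ?_⟩
  rintro _ ⟨k, rfl⟩
  have h1 : Real.exp (-((k : ℝ) - meanOf P S) ^ 2 / (2 * stdDevOf P S ^ 2)) ≤ 1 := by
    rw [Real.exp_le_one_iff, neg_div, neg_nonpos]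
    positivity
  have h2 := (Real.exp_pos (-((k : ℝ) - meanOf P S) ^ 2 / (2 * stdDevOf P S ^ 2))).le
  have h3 : stdDevOf P S * Real.sqrt (2 * Real.pi) * P.real {ω | (S ω : ℤ) = k} ≤
      stdDevOf P S * Real.sqrt (2 * Real.pi) :=
    mul_le_of_le_one_right (by positivity) measureReal_le_one
  have h4 : 0 ≤ stdDevOf P S * Real.sqrt (2 * Real.pi) * P.real {ω | (S ω : ℤ) = k} := by positivity
  rw [localLimitError, abs_le]
  constructor <;> linarith

theorem stdDevOf_sq {Ω : Type*} [MeasurableSpace Ω] {P : Measure Ω} {S : Ω → ℕ}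
    (hS : AEMeasurable S P) : stdDevOf P S ^ 2 = Var[fun ω => (S ω : ℝ); P] := by
  rw [stdDevOf, Real.sq_sqrt (integral_nonneg fun ω => sq_nonneg _), variance_eq_integral
    (show AEMeasurable (fun ω => (S ω : ℝ)) P from Measurable.of_discrete.comp_aemeasurable hS)]
  rfl

theorem GaussianCharFunBound.norm_charFunDefect_le {Ω : Type*} [MeasurableSpace Ω] {P : Measure Ω}
    {κ K : ℝ} {S : Ω → ℕ} (hS : AEMeasurable S P)
    (h : GaussianCharFunBound κ K (fun ω => (S ω : ℝ)) P) (hb : 0 < stdDevOf P S) (t : ℝ) :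
    ‖charFunDefect (charFun (P.map fun ω => (S ω : ℝ))) (meanOf P S) (stdDevOf P S) t‖ ≤
      Real.exp (-(κ * t ^ 2)) + Real.exp (-(1 / 2 * t ^ 2)) := by
  refine (_root_.norm_sub_le _ _).trans (add_le_add ?_ (le_of_eq ?_))
  · rw [Set.indicator_apply]
    split_ifs with ht
    · have hθ : |t / stdDevOf P S| ≤ Real.pi := by
        rw [abs_div, abs_of_pos hb, div_le_iff₀ hb, abs_le]
        exact ⟨ht.1.le, ht.2⟩
      have := h.norm_le _ hθ
      rw [← stdDevOf_sq hS] at this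
      rw [norm_mul, ← neg_mul, ← Complex.ofReal_mul, ← Complex.ofReal_neg,
        Complex.norm_exp_ofReal_mul_I, mul_one]
      refine this.trans_eq ?_
      congr 2
      field_simp
    · rw [norm_zero]
      positivity
  · rw [show -((t : ℂ) ^ 2 / 2) = ((-(1 / 2 * t ^ 2) : ℝ) : ℂ) by push_cast; ring,
      Complex.norm_exp_ofReal]

theorem GaussianCharFunBound.norm_charFunDefect_le_div {Ω : Type*} [MeasurableSpace Ω]
    {P : Measure Ω} {κ K : ℝ} {S : Ω → ℕ} (hS : AEMeasurable S P)
    (h : GaussianCharFunBound κ K (fun ω => (S ω : ℝ)) P) (hb : 0 < stdDevOf P S) {t : ℝ}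
    (ht : |t| ≤ stdDevOf P S) :
    ‖charFunDefect (charFun (P.map fun ω => (S ω : ℝ))) (meanOf P S) (stdDevOf P S) t‖ ≤
      K * |t| ^ 3 / stdDevOf P S := by
  have hlt : stdDevOf P S < Real.pi * stdDevOf P S := by
    have := Real.pi_gt_three
    nlinarith
  have hmem : t ∈ Set.Ioc (-(Real.pi * stdDevOf P S)) (Real.pi * stdDevOf P S) := by
    have := abs_le.1 ht
    constructor <;> linarith
  have hθ : |t / stdDevOf P S| ≤ 1 := by
    rw [abs_div, abs_of_pos hb]
    exact div_le_one_of_le₀ ht hb.le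
  have := h.norm_sub_le _ hθ
  rw [← stdDevOf_sq hS] at this
  rw [charFunDefect, Set.indicator_of_mem hmem]
  convert this using 1
  · congr 3
    push_cast
    have : (stdDevOf P S : ℂ) ≠ 0 := by exact_mod_cast hb.ne'
    field_simp
  · rw [abs_div, abs_of_pos hb]
    field_simp

theorem GaussianCharFunBound.tendsto_iSup_localLimitError {Ω : ℕ → Type*}
    [∀ N, MeasurableSpace (Ω N)] {P : ∀ N, Measure (Ω N)} [∀ N, IsProbabilityMeasure (P N)]
    {S : ∀ N, Ω N → ℕ} (hS : ∀ N, AEMeasurable (S N) (P N)) {κ K : ℝ} (hκ : 0 < κ)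
    (h : ∀ N, GaussianCharFunBound κ K (fun ω => (S N ω : ℝ)) (P N))
    (hb : Tendsto (fun N => stdDevOf (P N) (S N)) atTop atTop) :
    Tendsto (fun N => ⨆ k : ℤ, localLimitError (P N) (S N) k) atTop (𝓝 0) := by
  have hpos : ∀ᶠ N in atTop, 0 < stdDevOf (P N) (S N) := hb.eventually_gt_atTop 0
  have hlim : Tendsto (fun N => ∫ t : ℝ, ‖charFunDefect (charFun ((P N).map fun ω => (S N ω : ℝ)))
      (meanOf (P N) (S N)) (stdDevOf (P N) (S N)) t‖) atTop (𝓝 (∫ _ : ℝ, (0 : ℝ))) := by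
    refine tendsto_integral_filter_of_dominated_convergence
      (fun t => Real.exp (-(κ * t ^ 2)) + Real.exp (-(1 / 2 * t ^ 2))) ?_ ?_
      ((integrable_exp_neg_of_mul_sq hκ).add (integrable_exp_neg_of_mul_sq (by norm_num))) ?_
    · refine Eventually.of_forall fun N => ?_
      have : IsProbabilityMeasure ((P N).map fun ω => (S N ω : ℝ)) :=
        Measure.isProbabilityMeasure_map (h N).memLp.aemeasurable
      exact (measurable_charFunDefect measurable_charFun _ _).norm.aestronglyMeasurable
    · filter_upwards [hpos] with N hN
      refine ae_of_all _ fun t => ?_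
      rw [norm_norm]
      exact (h N).norm_charFunDefect_le (hS N) hN t
    · refine ae_of_all _ fun t => ?_
      refine squeeze_zero' (Eventually.of_forall fun N => norm_nonneg _) ?_
        (hb.const_div_atTop (K * |t| ^ 3))
      filter_upwards [hpos, hb.eventually_ge_atTop |t|] with N hN ht
      exact (h N).norm_charFunDefect_le_div (hS N) hN ht
  rw [integral_zero] at hlim
  have hlim' := hlim.const_mul (Real.sqrt (2 * Real.pi))⁻¹
  rw [mul_zero] at hlim'
  refine squeeze_zero' (Eventually.of_forall fun N => Real.iSup_nonneg fun k => abs_nonneg _) ?_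
    hlim'
  filter_upwards [hpos] with N hN
  exact ciSup_le fun k => localLimitError_le (hS N) hN k

theorem mainTheorem7
    (Ω : ℕ → Type*) [∀ N, MeasurableSpace (Ω N)]
    (P : ∀ N, Measure (Ω N)) [∀ N, IsProbabilityMeasure (P N)]
    (J : ℕ → ℕ) (X : ∀ N, Fin (J N) → Ω N → ℕ)
    (hindep : ∀ N, iIndepFun (X N) (P N))
    (J₁ J₂ : ∀ N, Set (Fin (J N)))
    (hunion : ∀ N, J₁ N ∪ J₂ N = Set.univ)
    (hdisj : ∀ N, Disjoint (J₁ N) (J₂ N))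
    (ρ : ∀ N, Fin (J N) → ℝ≥0) (c : ∀ N, Fin (J N) → ℕ) (lam : ∀ N, Fin (J N) → ℝ≥0)
    (hgeom : ∀ N, ∀ j ∈ J₁ N, HasLaw (X N j) (truncGeometricMeasure (ρ N j) (c N j)) (P N))
    (hlam : ∀ N, ∀ j ∈ J₂ N, 0 < lam N j)
    (hpois : ∀ N, ∀ j ∈ J₂ N, HasLaw (X N j) (poissonMeasure (lam N j)) (P N))
    (hC : ∃ C : ℕ, ∀ N, ∀ j ∈ J₁ N, c N j ≤ C)
    (hb : Tendsto (fun N => stdDevOf (P N) (fun ω => ∑ j, X N j ω)) atTop atTop) :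
    (∀ N, BddAbove (Set.range (localLimitError (P N) (fun ω => ∑ j, X N j ω)))) ∧
    Tendsto (fun N => ⨆ k : ℤ, localLimitError (P N) (fun ω => ∑ j, X N j ω) k)
      atTop (𝓝 0) := by
  refine ⟨fun N => bddAbove_range_localLimitError _ _, ?_⟩
  obtain ⟨C, hC⟩ := hC
  set κ : ℝ := 2 / (Real.pi ^ 2 * (C + 1) ^ 4) with hκ
  set K : ℝ := C * Real.exp C + C ^ 2 + Real.exp 1 with hK
  have hκ0 : 0 < κ := by positivity
  have hj : ∀ N j, AEMeasurable (X N j) (P N) ∧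
      GaussianCharFunBound κ K (fun ω => (X N j ω : ℝ)) (P N) := by
    intro N j
    rcases (hunion N).symm ▸ Set.mem_univ j with hj | hj
    · refine ⟨(hgeom N j hj).aemeasurable, .of_hasLaw (hgeom N j hj)
        ((gaussianCharFunBound_truncGeometric _ _).mono ?_ ?_)⟩
      · have : (c N j : ℝ) ≤ C := by exact_mod_cast hC N j hj
        rw [hκ]
        gcongr
      · have : (c N j : ℝ) ≤ C := by exact_mod_cast hC N j hj
        have h0 : 0 ≤ Real.exp 1 := Real.exp_nonneg 1
        refine le_trans ?_ (le_add_of_nonneg_right h0)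
        gcongr
    · refine ⟨(hpois N j hj).aemeasurable, .of_hasLaw (hpois N j hj)
        ((gaussianCharFunBound_poisson _).mono ?_ ?_)⟩
      · rw [hκ]
        refine div_le_div_of_nonneg_left (by norm_num) (by positivity)
          (le_mul_of_one_le_right (by positivity) (one_le_pow₀ ?_))
        have : (0 : ℝ) ≤ C := C.cast_nonneg
        linarith
      · rw [hK]
        have : (0 : ℝ) ≤ C * Real.exp C + C ^ 2 := by positivity
        linarith
  have hsum : ∀ N, GaussianCharFunBound κ K (fun ω => ((∑ j, X N j ω : ℕ) : ℝ)) (P N) := by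
    intro N
    have hi : iIndepFun (fun j ω => (X N j ω : ℝ)) (P N) :=
      (hindep N).comp (fun _ => (Nat.cast : ℕ → ℝ)) fun _ => .of_discrete
    convert GaussianCharFunBound.finsetSum (fun j => (hj N j).2) hi Finset.univ using 1
    ext ω
    simp
  exact GaussianCharFunBound.tendsto_iSup_localLimitError
    (fun N => Finset.aemeasurable_fun_sum _ fun j _ => (hj N j).1) hκ0 hsum hb
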